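/- Let $\mathcal T$ be a triangulated category with small coproducts and shift functor $\Sigma$. Write $\mathcal T^c$ for the full subcategory of compact objects (those $c$ for which $\mathrm{Hom}(c,-)$ respects small coproducts). A compact generator is an object $G\in\mathcal T^c$ such that the only objects $X$ with $\mathrm{Hom}(\Sigma^iG,X)=0$ for all $i\in\mathbb Z$ are the zero objects. For full subcategories $\mathcal A,\mathcal B$, let $\mathcal A*\mathcal B$ consist of the objects $x$ that admit a distinguished triangle $a\to x\to b\to\Sigma a$ with $a\in\mathcal A$, $b\in\mathcal B$. Let $\mathrm{Coprod}(\mathcal A)$ be the smallest full subcategory containing $\mathcal A$, closed under small coproducts, and satisfying $\mathcal S*\mathcal S\subseteq\mathcal S$. For $G\in\mathcal T$ and $-\infty\le m\le n\le\infty$ put $G[m,n]=\{\Sigma^iG : i\in\mathbb Z,\ m\le -i\le n\}$, written $G(-\infty,n]$ when $m=-\infty$. Assume that $\mathcal T$ is *weakly approximable*: there exist an integer $A>0$, a compact generator $G$ and a t-structure on $\mathcal T$ such that $G\in\mathcal T^{\le A}$, $\mathrm{Hom}(G,\mathcal T^{\le -A})=0$, and every $F\in\mathcal T^{\le 0}$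 admits a distinguished triangle $E\to F\to D\to\Sigma E$ with $D\in\mathcal T^{\le -1}$ and $E$ a direct summand of an object of $\mathrm{Coprod}(G[-A,A])$. Let $(\mathcal T^{\le 0},\mathcal T^{\ge 1})$ be any t-structure on $\mathcal T$ in the preferred equivalence class, that is, such that for some compact generator $H$ and some integer $N>0$ one has $\mathcal T^{\le -N}\subseteq\mathrm{Coprod}(H(-\infty,0])\subseteq\mathcal T^{\le N}$. Put $\mathcal T^-=\bigcup_m\mathcal T^{\le m}$, $\mathcal T^+=\bigcup_m\mathcal T^{\ge -m}$, $\mathcal T^b=\mathcal T^-\cap\mathcal T^+$, $\mathcal T^-_c=\bigcap_{m\ge 1}(\mathcal T^c*\mathcal T^{\le -m})$, $\mathcal T^b_c=\mathcal T^-_c\cap\mathcal T^b$ and $\mathcal T^{c,b}=\mathcal T^b_c\cap\mathcal T^c$. Then: (i) $\mathcal T^c\subseteq\mathcal T^-_c$, and $\mathcal T^c$ consists of exactly those $F\in\mathcal T^-_c$ such that for every $Q\in\mathcal T^-_c$ there is an integer $N>0$ with $\mathrm{Hom}(F,\Sigma^nQ)=0$ for all $n>N$. Moreover, let $G\in\mathcal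 T^c$ be any classical generator of $\mathcal T^c$, that is, an object such that $\mathcal T^c$ is the smallest thick triangulated subcategory of $\mathcal T$ containing $G$. Then: (ii) $\mathcal T^b_c=\bigcup_{n=1}^\infty\big(G(-\infty,-n]\big)^\perp$, where the perpendicular is taken in $\mathcal T^-_c$: it consists of the $X\in\mathcal T^-_c$ with $\mathrm{Hom}(a,X)=0$ for all $a\in G(-\infty,-n]$. (iii) $\mathcal T^{c,b}=\bigcup_{n=1}^\infty\big(G(-\infty,-n]\big)^\perp$, where the perpendicular is taken in $\mathcal T^c$: it consists of the $X\in\mathcal T^c$ with $\mathrm{Hom}(a,X)=0$ for all $a\in G(-\infty,-n]$. -/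

import Mathlib

open CategoryTheory CategoryTheory.Limits CategoryTheory.Pretriangulated
  CategoryTheory.Triangulated Opposite

universe v u

namespace WeakApprox

section

variable {C : Type u} [Category.{v} C] [HasZeroObject C] [HasShift C ℤ] [Preadditive C]
  [∀ n : ℤ, (shiftFunctor C n).Additive] [Pretriangulated C]

/-- The full subcategory `𝒯ᶜ` of compact objects: those `c` for which `Hom(c, -)`, as a functor to
abelian groups, respects small coproducts. -/
def compactObjects (C : Type u) [Category.{v} C] [Preadditive C] : ObjectProperty C :=
  fun c ↦ ∀ J : Type v,
    PreservesColimitsOfShape (Discrete J) (preadditiveCoyoneda.obj (op c))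

/-- `G` is a compact generator: it is compact, and an object which receives only zero maps from all
the shifts of `G` is zero. -/
def IsCompactGenerator (G : C) : Prop :=
  compactObjects C G ∧
    ∀ X : C, (∀ (n : ℤ) (f : G⟦n⟧ ⟶ X), f = 0) → IsZero X

/-- `G` is a classical generator of `𝒯ᶜ`: the smallest thick triangulated subcategory that
contains `G` is `𝒯ᶜ`. -/
def IsClassicalGenerator (G : C) : Prop :=
  (ObjectProperty.singleton G).triangEnvelope = compactObjects C

/-- The subcategory `G[I]` of the (isomorphs of) shifts `G⟦i⟧` with `-i ∈ I`. So `G[m, n]` is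
`shifts G (Set.Icc m n)`, and `G(-∞, n]` is `shifts G (Set.Iic n)`. -/
def shifts (G : C) (I : Set ℤ) : ObjectProperty C :=
  fun X ↦ ∃ i : ℤ, -i ∈ I ∧ Nonempty (X ≅ G⟦i⟧)

/-- `Coprod(𝒜)`: the smallest full subcategory `S` with `𝒜 ⊆ S` and `S * S ⊆ S`, and which is
closed under small coproducts. -/
def coprodClosure (A : ObjectProperty C) : ObjectProperty C :=
  fun X ↦ ∀ S : ObjectProperty C, A ≤ S → ObjectProperty.extensionProduct S S ≤ S →
    (∀ J : Type v, S.colimitsOfShape (Discrete J) ≤ S) → S X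

/-- A category with coproducts `C` is weakly approximable if there are an integer `A > 0`, a
compact generator `G` and a t-structure such that `G ∈ 𝒯^{≤ A}`, `Hom(G, 𝒯^{≤ -A}) = 0`, and each
`F ∈ 𝒯^{≤ 0}` sits in a distinguished triangle `E ⟶ F ⟶ D ⟶ E⟦1⟧` with `D ∈ 𝒯^{≤ -1}` and `E` a
direct summand of an object of `Coprod(G[-A, A])`. -/
def IsWeaklyApproximable (C : Type u) [Category.{v} C] [HasZeroObject C] [HasShift C ℤ]
    [Preadditive C] [∀ n : ℤ, (shiftFunctor C n).Additive] [Pretriangulated C] : Prop :=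
  HasCoproducts.{v} C ∧
  ∃ (A : ℤ) (G : C) (t : TStructure C), 0 < A ∧ IsCompactGenerator G ∧
    t.le A G ∧
    (∀ (X : C) (f : G ⟶ X), t.le (-A) X → f = 0) ∧
    ∀ F : C, t.le 0 F →
      ObjectProperty.extensionProduct
        (coprodClosure (shifts G (Set.Icc (-A) A))).retractClosure (t.le (-1)) F

/-- `t` lies in the preferred equivalence class of t-structures: for a compact generator `G` there
is `N > 0` with `𝒯^{≤ -N} ⊆ Coprod(G(-∞, 0]) ⊆ 𝒯^{≤ N}`, that is, `t` is equivalent to the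
t-structure with aisle `Coprod(G(-∞, 0])`. -/
def IsPreferred (t : TStructure C) : Prop :=
  ∃ G : C, IsCompactGenerator G ∧ ∃ N : ℤ, 0 < N ∧
    t.le (-N) ≤ coprodClosure (shifts G (Set.Iic 0)) ∧
    coprodClosure (shifts G (Set.Iic 0)) ≤ t.le N

/-- The subcategory `𝒯⁻_c` of pseudo-compact objects: the intersection over the integers `m > 0`
of `𝒯ᶜ * 𝒯^{≤ -m}`. -/
def pseudoCompact (t : TStructure C) : ObjectProperty C :=
  fun F ↦ ∀ m : ℤ, 0 < m → ObjectProperty.extensionProduct (compactObjects C) (t.le (-m)) F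

/-- The subcategory `𝒯ᵇ_c = 𝒯⁻_c ∩ 𝒯ᵇ` of bounded pseudo-compact objects. -/
def boundedPseudoCompact (t : TStructure C) : ObjectProperty C :=
  pseudoCompact t ⊓ t.bounded

/-- The subcategory `𝒯^{c,b} = 𝒯ᵇ_c ∩ 𝒯ᶜ` of bounded compact objects. -/
def boundedCompact (t : TStructure C) : ObjectProperty C :=
  boundedPseudoCompact t ⊓ compactObjects C

/-- The perpendicular `A^⊥` taken in the full subcategory `S`: the objects `X` of `S` such that
every map to `X` from an object of `A` is zero. -/
def perpIn (S A : ObjectProperty C) : ObjectProperty C :=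
  S ⊓ A.rightOrthogonal

end

end WeakApprox

/-! Everything rests on two bounds for a compact K: it lies in some 𝒯^{≤ n}, and Hom(K, 𝒯^{≤ m}) = 0
for some m (`exists_le_of_compact`, `exists_leftOrthogonal_of_compact`). Both come from one
telescope argument: if every map from a shift of a compact generator to a term of F_0 → F_1 → ⋯
eventually dies, then 1 - shift is invertible on ∐ F_k, and every map K → F_0 dies in some F_l
(`exists_comp_map_eq_zero`). The truncations τ^{≥ k} K give the first bound, iterated approximations
of K the second.

The bounds give the vanishing in (i) for compact F. Conversely, take triangles E_k → F → D_k with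
E_k compact and D_k ∈ 𝒯^{≤ -2k}, and test F on the single pseudo-compact object Q = ∐ Σ^{-k} D_k:
vanishing of Hom(F, Σ^k Q) for one k makes F → D_k zero, so F is a retract of E_k.

For (ii) and (iii), pseudo-compact objects are bounded above, so only boundedness below is at stake.
The Y with Hom(Σ^i Y, X) = 0 for i ≫ 0 form a thick subcategory, so vanishing for G passes to the
compact generator H of the preferred class, and 𝒯^{≤ -N} ⊆ Coprod(H(-∞, 0]) turns it into a lower
bound for X. -/

namespace WeakApprox

/-! ### Compactness as finite support of maps into coproducts -/

section Compact

/-- Every element of a coproduct of abelian groups is a finite sum of elements of the summands. -/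
lemma exists_eq_sum_of_isColimit {J : Type v} {A : J → AddCommGrpCat.{v}} {c : Cofan A}
    (hc : IsColimit c) (x : c.pt) :
    ∃ (s : Finset J) (g : ∀ j, A j), x = ∑ j ∈ s, (c.inj j).hom (g j) := by
  classical
  let S : AddSubgroup c.pt := ⨆ j, (c.inj j).hom.range
  have hS (j : J) (a : A j) : (c.inj j).hom a ∈ S :=
    AddSubgroup.mem_iSup_of_mem j ⟨a, rfl⟩
  -- The quotient by the sum of the images receives only the zero map from each summand, so it
  -- vanishes.
  have hq : AddCommGrpCat.ofHom (QuotientAddGroup.mk' S) = 0 := by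
    refine Cofan.IsColimit.hom_ext hc _ _ fun j ↦ ?_
    ext a
    simpa using hS j a
  have hx : x ∈ S := by
    rw [← QuotientAddGroup.eq_zero_iff]
    exact congr($(hq).hom x)
  induction hx using AddSubgroup.iSup_induction' with
  | hp j x hx =>
    obtain ⟨a, rfl⟩ := hx
    refine ⟨{j}, Function.update 0 j a, ?_⟩
    simp
  | h1 => exact ⟨∅, 0, by simp⟩
  | hadd x y _ _ hx hy =>
    obtain ⟨s, g, rfl⟩ := hx
    obtain ⟨s', g', rfl⟩ := hy
    refine ⟨s ∪ s', fun j ↦ (if j ∈ s then g j else 0) + (if j ∈ s' then g' j else 0), ?_⟩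
    simp only [map_add, Finset.sum_add_distrib]
    congr 1
    · rw [← Finset.sum_subset Finset.subset_union_left (by intro j _ hj; simp [hj])]
      exact Finset.sum_congr rfl fun j hj ↦ by simp [hj]
    · rw [← Finset.sum_subset Finset.subset_union_right (by intro j _ hj; simp [hj])]
      exact Finset.sum_congr rfl fun j hj ↦ by simp [hj]

variable {C : Type u} [Category.{v} C] [Preadditive C]

/-- A morphism to the point of a cofan is finitely supported if it is a finite sum of morphisms
which factor through the inclusions. -/
def FinSupp {J : Type*} {X : J → C} (c : Cofan X) {a : C} (f : a ⟶ c.pt) : Prop :=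
  ∃ (s : Finset J) (g : ∀ j, a ⟶ X j), f = ∑ j ∈ s, g j ≫ c.inj j

namespace FinSupp

variable {J : Type*} {X : J → C} {c : Cofan X} {a b : C}

lemma single (j : J) (g : a ⟶ X j) : FinSupp c (g ≫ c.inj j) := by
  classical
  exact ⟨{j}, Function.update 0 j g, by simp⟩

lemma zero : FinSupp c (0 : a ⟶ c.pt) := ⟨∅, 0, by simp⟩

lemma add {f f' : a ⟶ c.pt} (h : FinSupp c f) (h' : FinSupp c f') : FinSupp c (f + f') := by
  classical
  obtain ⟨s, g, rfl⟩ := h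
  obtain ⟨s', g', rfl⟩ := h'
  refine ⟨s ∪ s', fun j ↦ (if j ∈ s then g j else 0) + (if j ∈ s' then g' j else 0), ?_⟩
  simp only [Preadditive.add_comp, Finset.sum_add_distrib]
  congr 1
  · rw [← Finset.sum_subset Finset.subset_union_left (by intro j _ hj; simp [hj])]
    exact Finset.sum_congr rfl fun j hj ↦ by simp [hj]
  · rw [← Finset.sum_subset Finset.subset_union_right (by intro j _ hj; simp [hj])]
    exact Finset.sum_congr rfl fun j hj ↦ by simp [hj]

lemma sum {ι : Type*} (s : Finset ι) (f : ι → (a ⟶ c.pt)) (h : ∀ i ∈ s, FinSupp c (f i)) :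
    FinSupp c (∑ i ∈ s, f i) :=
  Finset.sum_induction _ _ (fun _ _ ↦ add) zero h

lemma comp {f : a ⟶ c.pt} (h : FinSupp c f) (g : b ⟶ a) : FinSupp c (g ≫ f) := by
  obtain ⟨s, k, rfl⟩ := h
  exact ⟨s, fun j ↦ g ≫ k j, by simp [Preadditive.comp_sum]⟩

end FinSupp

/-- The projection of a coproduct to one of its summands. -/
noncomputable def proj {J : Type*} {X : J → C} {c : Cofan X} (hc : IsColimit c) (j : J) :
    c.pt ⟶ X j := by
  classical
  exact Cofan.IsColimit.desc hc fun i ↦ if h : i = j then eqToHom (congrArg X h) else 0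

section proj

variable {J : Type*} {X : J → C} {c : Cofan X} (hc : IsColimit c)

@[simp]
lemma inj_proj_self (j : J) : c.inj j ≫ proj hc j = 𝟙 _ := by
  simp [proj]

lemma inj_proj_of_ne {i j : J} (h : i ≠ j) : c.inj i ≫ proj hc j = 0 := by
  simp [proj, h]

@[simp]
lemma inj_proj_self_assoc (j : J) {Y : C} (f : X j ⟶ Y) : c.inj j ≫ proj hc j ≫ f = f := by
  rw [← Category.assoc, inj_proj_self, Category.id_comp]

lemma inj_proj_of_ne_assoc {i j : J} (h : i ≠ j) {Y : C} (f : X j ⟶ Y) :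
    c.inj i ≫ proj hc j ≫ f = 0 := by
  rw [← Category.assoc, inj_proj_of_ne hc h, zero_comp]

lemma sum_proj {a : C} (s : Finset J) (g : ∀ j, a ⟶ X j) (j : J) [Decidable (j ∈ s)] :
    (∑ i ∈ s, g i ≫ c.inj i) ≫ proj hc j = if j ∈ s then g j else 0 := by
  rw [Preadditive.sum_comp]
  split_ifs with h
  · rw [Finset.sum_eq_single_of_mem j h fun i _ hi ↦ by simp [inj_proj_of_ne hc hi]]
    simp
  · refine Finset.sum_eq_zero fun i hi ↦ ?_
    rw [Category.assoc, inj_proj_of_ne hc (by rintro rfl; exact h hi), comp_zero]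

lemma FinSupp.exists_eq_sum_proj {a : C} {f : a ⟶ c.pt} (h : FinSupp c f) :
    ∃ s : Finset J, (∀ j ∉ s, f ≫ proj hc j = 0) ∧ f = ∑ j ∈ s, (f ≫ proj hc j) ≫ c.inj j := by
  classical
  obtain ⟨s, g, rfl⟩ := h
  refine ⟨s, fun j hj ↦ by rw [sum_proj, if_neg hj], ?_⟩
  refine Finset.sum_congr rfl fun j hj ↦ ?_
  rw [sum_proj, if_pos hj]

lemma FinSupp.eq_zero {a : C} {f : a ⟶ c.pt} (h : FinSupp c f)
    (hf : ∀ j, f ≫ proj hc j = 0) : f = 0 := by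
  obtain ⟨s, -, hs⟩ := h.exists_eq_sum_proj hc
  rw [hs]
  exact Finset.sum_eq_zero fun j _ ↦ by rw [hf, zero_comp]

end proj

lemma finSupp_of_compact {c : C} (hc : compactObjects C c) {J : Type v} {X : J → C}
    {s : Cofan X} (hs : IsColimit s) (f : c ⟶ s.pt) : FinSupp s f := by
  have := hc J
  exact exists_eq_sum_of_isColimit (Cofan.isColimitMapCoconeEquiv
    (preadditiveCoyoneda.obj (op c)) X s (isColimitOfPreserves _ hs)) f

lemma finSupp_of_compact_nat {c : C} (hc : compactObjects C c) {X : ℕ → C}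
    {s : Cofan X} (hs : IsColimit s) (f : c ⟶ s.pt) : FinSupp s f := by
  let e : ULift.{v} ℕ ≃ ℕ := Equiv.ulift
  obtain ⟨t, g, h⟩ := finSupp_of_compact hc (s.isColimitEquivOfEquiv e hs) f
  rw [h]
  exact FinSupp.sum (c := s) _ _ fun j _ ↦ FinSupp.single (e j) (g j)

/-- Finite support is surjectivity of the comparison map; its injectivity is automatic, since the
projections of the coproduct recover each component. -/
lemma compact_of_finSupp [HasCoproducts.{v} C] {c : C}
    (h : ∀ (J : Type v) (X : J → C) (s : Cofan X) (_ : IsColimit s) (f : c ⟶ s.pt),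
      FinSupp s f) : compactObjects C c := by
  intro J
  refine @preservesColimitsOfShape_of_discrete _ _ _ _ _ _ fun X ↦ ?_
  let F := preadditiveCoyoneda.obj (op c)
  have hX := coproductIsCoproduct X
  have : IsIso (sigmaComparison F X) := by
    rw [ConcreteCategory.isIso_iff_bijective]
    constructor
    · change Function.Injective (sigmaComparison F X).hom
      rw [injective_iff_map_eq_zero]
      intro x hx
      obtain ⟨s, g, rfl⟩ := exists_eq_sum_of_isColimit
        (coproductIsCoproduct fun j ↦ F.obj (X j)) x
      have key (j : J) (y : F.obj (X j)) :
          (sigmaComparison F X).hom ((Sigma.ι (fun j ↦ F.obj (X j)) j).hom y) =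
            (show c ⟶ X j from y) ≫ Sigma.ι X j :=
        congr($(ι_comp_sigmaComparison F X j).hom y)
      have hx' : ∑ j ∈ s, (show c ⟶ X j from g j) ≫ (Cofan.mk _ (Sigma.ι X)).inj j = 0 := by
        refine Eq.trans ?_ hx
        rw [map_sum]
        exact Finset.sum_congr rfl fun j _ ↦ (key j (g j)).symm
      refine Finset.sum_eq_zero fun j hj ↦ ?_
      classical
      have := sum_proj hX s (fun j ↦ (show c ⟶ X j from g j)) j
      rw [hx', if_pos hj, zero_comp] at this
      rw [show g j = 0 from this.symm, map_zero]
    · intro f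
      obtain ⟨s, g, hf⟩ := h J X _ hX f
      refine ⟨∑ j ∈ s, (Sigma.ι (fun j ↦ F.obj (X j)) j).hom (g j), ?_⟩
      change (sigmaComparison F X).hom _ = _
      rw [map_sum]
      refine Eq.trans (Finset.sum_congr rfl fun j _ ↦ ?_) hf.symm
      exact congr($(ι_comp_sigmaComparison F X j).hom (g j))
  exact PreservesCoproduct.of_iso_comparison F X

end Compact

end WeakApprox

namespace WeakApprox

/-! ### Closure properties of compact objects -/

section Compact

variable {C : Type u} [Category.{v} C] [Preadditive C]

/-- Subtracting from `f` its components on the finite support of `i ≫ f` leaves a map killed by `i`;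
this gives closure of compact objects under extensions. -/
lemma FinSupp.of_restrict {J : Type*} {X : J → C} {s : Cofan X} (hs : IsColimit s)
    {a b : C} {f : b ⟶ s.pt} (i : a ⟶ b) (hi : FinSupp s (i ≫ f))
    (h : ∀ g : b ⟶ s.pt, i ≫ g = 0 → FinSupp s g) : FinSupp s f := by
  obtain ⟨S, -, hS⟩ := hi.exists_eq_sum_proj hs
  have h₁ := h (f - ∑ j ∈ S, (f ≫ proj hs j) ≫ s.inj j) (by
    rw [Preadditive.comp_sub, sub_eq_zero, Preadditive.comp_sum, hS]
    simp only [Category.assoc])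
  have h₂ : FinSupp s (∑ j ∈ S, (f ≫ proj hs j) ≫ s.inj j) := ⟨S, _, rfl⟩
  simpa using h₁.add h₂

lemma compact_of_isZero [HasCoproducts.{v} C] {c : C} (hc : IsZero c) : compactObjects C c :=
  compact_of_finSupp fun _ _ s _ f ↦ by
    rw [hc.eq_of_src f 0]
    exact FinSupp.zero

lemma compact_of_retract [HasCoproducts.{v} C] {a b : C} (r : Retract a b)
    (hb : compactObjects C b) : compactObjects C a :=
  compact_of_finSupp fun _ _ s hs f ↦ by
    simpa using (finSupp_of_compact hb hs (r.r ≫ f)).comp r.i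

/-- A coproduct with finitely many nonzero summands, all of which are compact, is compact. -/
lemma compact_of_isColimit_nat [HasCoproducts.{v} C] {K : ℕ → C} {s : Cofan K} (hs : IsColimit s)
    (h : ∀ j, compactObjects C (K j)) (M : ℕ) (hM : ∀ j, M ≤ j → IsZero (K j)) :
    compactObjects C s.pt :=
  compact_of_finSupp fun _ _ t _ f ↦ by
    have hf : f = ∑ j ∈ Finset.range M, proj hs j ≫ s.inj j ≫ f := by
      refine Cofan.IsColimit.hom_ext hs _ _ fun i ↦ ?_
      by_cases hi : i < M
      · rw [Preadditive.comp_sum, Finset.sum_eq_single_of_mem i (Finset.mem_range.2 hi)]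
        · simp
        · intro j _ hj
          rw [inj_proj_of_ne_assoc hs hj.symm]
      · exact (hM i (not_lt.1 hi)).eq_of_src _ _
    rw [hf]
    exact FinSupp.sum _ _ fun j _ ↦ (finSupp_of_compact (h j) ‹_› _).comp _

variable [HasShift C ℤ] [∀ n : ℤ, (shiftFunctor C n).Additive]

lemma compact_shift [HasCoproducts.{v} C] {c : C} (hc : compactObjects C c) (n : ℤ) :
    compactObjects C (c⟦n⟧) :=
  compact_of_finSupp fun J X s hs f ↦ by
    let e : c⟦n⟧⟦-n⟧ ≅ c := (shiftEquiv C n).unitIso.symm.app c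
    have hs' := Cofan.isColimitMapCoconeEquiv (shiftFunctor C (-n)) X s
      (isColimitOfPreserves (shiftFunctor C (-n)) hs)
    obtain ⟨S, g, hg⟩ := finSupp_of_compact hc hs' (e.inv ≫ f⟦-n⟧')
    refine ⟨S, fun j ↦ (shiftFunctor C (-n)).preimage (e.hom ≫ g j), ?_⟩
    apply (shiftFunctor C (-n)).map_injective
    rw [← cancel_epi e.inv, hg, Functor.map_sum, Preadditive.comp_sum]
    simp

variable [HasZeroObject C] [Pretriangulated C]

lemma compact_isTriangulated (hC : HasCoproducts.{v} C) :
    (compactObjects C).IsTriangulated :=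
  have : (compactObjects C).IsStableUnderRetracts := ⟨compact_of_retract⟩
  { exists_zero := ⟨_, isZero_zero C, compact_of_isZero (isZero_zero C)⟩
    isStableUnderShiftBy := fun n ↦ ⟨fun _ hc ↦ compact_shift hc n⟩
    toIsTriangulatedClosed₂ := .mk' fun T hT h₁ h₃ ↦ compact_of_finSupp fun _ _ s hs f ↦
      FinSupp.of_restrict hs T.mor₁ (finSupp_of_compact h₁ hs _) fun g hg ↦ by
        obtain ⟨g, rfl⟩ := T.yoneda_exact₂ hT g hg
        exact (finSupp_of_compact h₃ hs g).comp _ }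

end Compact

/-! ### Telescopes and vanishing at a finite stage -/

section Telescope

variable {C : Type u} [Category.{v} C] [Preadditive C] {F : ℕ ⥤ C} {s : Cofan F.obj}
  (hs : IsColimit s)

/-- The difference of the identity of the coproduct of a sequence and of the shift map. -/
noncomputable def telescope : s.pt ⟶ s.pt :=
  Cofan.IsColimit.desc hs fun k ↦ s.inj k - F.map (homOfLE k.le_succ) ≫ s.inj (k + 1)

lemma inj_telescope (k : ℕ) :
    s.inj k ≫ telescope hs = s.inj k - F.map (homOfLE k.le_succ) ≫ s.inj (k + 1) :=
  Cofan.IsColimit.fac hs _ k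

lemma telescope_proj_zero : telescope hs ≫ proj hs 0 = proj hs 0 := by
  refine Cofan.IsColimit.hom_ext hs _ _ fun i ↦ ?_
  rw [← Category.assoc, inj_telescope, Preadditive.sub_comp, Category.assoc,
    inj_proj_of_ne hs (Nat.succ_ne_zero i), comp_zero, sub_zero]

lemma telescope_proj_succ (k : ℕ) : telescope hs ≫ proj hs (k + 1) =
    proj hs (k + 1) - proj hs k ≫ F.map (homOfLE k.le_succ) := by
  refine Cofan.IsColimit.hom_ext hs _ _ fun i ↦ ?_
  rw [← Category.assoc, inj_telescope, Preadditive.sub_comp, Category.assoc, Preadditive.comp_sub]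
  congr 1
  by_cases h : i = k
  · subst h
    rw [inj_proj_self, inj_proj_self_assoc, Category.comp_id]
  · rw [inj_proj_of_ne hs (by simpa using h), inj_proj_of_ne_assoc hs h, comp_zero]

lemma eq_zero_of_comp_telescope {a : C} {g : a ⟶ s.pt} (hg : FinSupp s g)
    (h : g ≫ telescope hs = 0) : g = 0 := by
  refine hg.eq_zero hs fun k ↦ ?_
  induction k with
  | zero => rw [← telescope_proj_zero, reassoc_of% h, zero_comp]
  | succ k ih =>
    have := g ≫= telescope_proj_succ hs k
    rwa [reassoc_of% h, zero_comp, Preadditive.comp_sub, reassoc_of% ih, zero_comp, sub_zero,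
      eq_comm] at this

/-- The preimage is the sum of the successive images of `f`, placed in degrees `k, …, l - 1`; it is
finite because `f` dies at stage `l`. -/
lemma exists_comp_telescope_eq_inj {a : C} (n : ℕ) : ∀ (k l : ℕ) (h : k ≤ l) (_ : l - k = n)
    (f : a ⟶ F.obj k), f ≫ F.map (homOfLE h) = 0 → ∃ g, g ≫ telescope hs = f ≫ s.inj k := by
  induction n with
  | zero =>
    intro k l h hn f hf
    obtain rfl : k = l := by omega
    refine ⟨0, ?_⟩
    have : f = 0 := by simpa using hf
    simp [this]
  | succ n ih =>
    intro k l h hn f hf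
    obtain ⟨g, hg⟩ := ih (k + 1) l (by omega) (by omega) (f ≫ F.map (homOfLE k.le_succ)) (by
      rw [Category.assoc, ← F.map_comp]
      exact hf)
    exact ⟨f ≫ s.inj k + g, by simp [hg, inj_telescope]⟩

lemma exists_comp_telescope_eq {a : C}
    (ha : ∀ (k : ℕ) (f : a ⟶ F.obj k), ∃ (l : ℕ) (h : k ≤ l), f ≫ F.map (homOfLE h) = 0)
    {f : a ⟶ s.pt} (hf : FinSupp s f) : ∃ g, g ≫ telescope hs = f := by
  obtain ⟨S, g, rfl⟩ := hf
  have (j : ℕ) : ∃ k, k ≫ telescope hs = g j ≫ s.inj j := by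
    obtain ⟨l, h, hl⟩ := ha j (g j)
    exact exists_comp_telescope_eq_inj hs _ j l h rfl _ hl
  choose k hk using this
  exact ⟨∑ j ∈ S, k j, by simp [Preadditive.sum_comp, hk]⟩

/-- The equation determines the components of `g` recursively: the n-th one is the image of `f` in
`F.obj n`. -/
lemma comp_map_eq_proj {a : C} {f : a ⟶ F.obj 0} {g : a ⟶ s.pt}
    (h : g ≫ telescope hs = f ≫ s.inj 0) (n : ℕ) :
    f ≫ F.map (homOfLE n.zero_le) = g ≫ proj hs n := by
  induction n with
  | zero =>
    rw [← telescope_proj_zero, reassoc_of% h, inj_proj_self]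
    simp
  | succ n ih =>
    have := g ≫= telescope_proj_succ hs n
    rw [reassoc_of% h, inj_proj_of_ne hs n.succ_ne_zero.symm, comp_zero, Preadditive.comp_sub,
      eq_comm, sub_eq_zero, ← reassoc_of% ih, ← F.map_comp] at this
    exact this.symm

variable [HasZeroObject C] [HasShift C ℤ] [∀ n : ℤ, (shiftFunctor C n).Additive] [Pretriangulated C]

/-- The telescope map is bijective on maps from shifts of `G`, so its cone receives only zero maps
from them. -/
lemma isIso_telescope (hC : HasCoproducts.{v} C) {G : C} (hG : IsCompactGenerator G)
    (hF : ∀ (i : ℤ) (k : ℕ) (f : G⟦i⟧ ⟶ F.obj k), ∃ (l : ℕ) (h : k ≤ l),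
      f ≫ F.map (homOfLE h) = 0) : IsIso (telescope hs) := by
  obtain ⟨Z, b, c, hT⟩ := distinguished_cocone_triangle (telescope hs)
  refine (Triangle.isZero₃_iff_isIso₁ _ hT).1 (hG.2 Z fun n f ↦ ?_)
  have hc (i : ℤ) (g : G⟦i⟧ ⟶ s.pt) : FinSupp s g :=
    finSupp_of_compact_nat (compact_shift hG.1 i) hs g
  have hfc : f ≫ c = 0 := by
    let e : G⟦n - 1⟧⟦(1 : ℤ)⟧ ≅ G⟦n⟧ := ((shiftFunctorAdd' C (n - 1) 1 n (by simp)).app G).symm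
    obtain ⟨u, hu⟩ := (shiftFunctor C (1 : ℤ)).map_surjective (e.hom ≫ f ≫ c)
    have : u = 0 := eq_zero_of_comp_telescope hs (hc _ u) (by
      apply (shiftFunctor C (1 : ℤ)).map_injective
      have h₃₁ : c ≫ (telescope hs)⟦(1 : ℤ)⟧' = 0 := comp_distTriang_mor_zero₃₁ _ hT
      simp [hu, h₃₁])
    rw [← cancel_epi e.hom, ← hu, this, Functor.map_zero, comp_zero]
  obtain ⟨g, rfl⟩ : ∃ g : G⟦n⟧ ⟶ s.pt, f = g ≫ b := Triangle.coyoneda_exact₃ _ hT f hfc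
  obtain ⟨h, rfl⟩ := exists_comp_telescope_eq hs (hF n) (hc n g)
  have h₁₂ : telescope hs ≫ b = 0 := comp_distTriang_mor_zero₁₂ _ hT
  rw [Category.assoc, h₁₂, comp_zero]

/-- If the maps from the shifts of a compact generator to a sequence of objects vanish in the
colimit, then so do the maps from all the compact objects. -/
lemma exists_comp_map_eq_zero (hC : HasCoproducts.{v} C) {G : C} (hG : IsCompactGenerator G)
    (F : ℕ ⥤ C) (hF : ∀ (i : ℤ) (k : ℕ) (f : G⟦i⟧ ⟶ F.obj k), ∃ (l : ℕ) (h : k ≤ l),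
      f ≫ F.map (homOfLE h) = 0) {c : C} (hc : compactObjects C c) (f : c ⟶ F.obj 0) :
    ∃ l : ℕ, f ≫ F.map (homOfLE l.zero_le) = 0 := by
  have : HasColimitsOfShape (Discrete ℕ) C :=
    hasColimitsOfShape_of_equivalence (Discrete.equivalence (Equiv.ulift.{v} (α := ℕ)))
  have hs := coproductIsCoproduct F.obj
  have := isIso_telescope hs hC hG hF
  let g := f ≫ (Cofan.mk _ (Sigma.ι F.obj)).inj 0 ≫ inv (telescope hs)
  have hg : g ≫ telescope hs = f ≫ (Cofan.mk _ (Sigma.ι F.obj)).inj 0 := by simp [g]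
  obtain ⟨S, hS, -⟩ := (finSupp_of_compact_nat hc hs g).exists_eq_sum_proj hs
  -- Outside the finite support of `g` its component, which is `f` pushed to stage `l`, is zero.
  obtain ⟨l, hl⟩ := S.exists_notMem
  exact ⟨l, (comp_map_eq_proj hs hg l).trans (hS l hl)⟩

end Telescope

end WeakApprox

namespace WeakApprox

/-! ### Orthogonals, Coprod and aisles -/

section Orthogonal

variable {C : Type u} [Category.{v} C] [Preadditive C]

instance (P : ObjectProperty C) : P.leftOrthogonal.IsStableUnderRetracts where
  of_retract r h Y f hY := by
    rw [← Category.id_comp f, ← r.retract, Category.assoc, h (r.r ≫ f) hY, comp_zero]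

lemma leftOrthogonal_colimitsOfShape_le (P : ObjectProperty C) (J : Type*) [Category* J] :
    P.leftOrthogonal.colimitsOfShape J ≤ P.leftOrthogonal := by
  rintro X ⟨hX⟩ Y f hY
  exact hX.isColimit.hom_ext fun j ↦ by simpa using hX.prop_diag_obj j _ hY

variable [HasZeroObject C] [HasShift C ℤ] [∀ n : ℤ, (shiftFunctor C n).Additive] [Pretriangulated C]

/-- A left orthogonal is closed under extensions and coproducts, so orthogonality need only be
tested on generators. -/
lemma coprodClosure_le_leftOrthogonal {A P : ObjectProperty C} (h : A ≤ P.leftOrthogonal) :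
    coprodClosure A ≤ P.leftOrthogonal := fun _ hX ↦
  hX _ h (ObjectProperty.extensionProduct_le_of_isTriangulatedClosed₂ le_rfl le_rfl)
    fun J ↦ leftOrthogonal_colimitsOfShape_le P (Discrete J)

lemma le_coprodClosure (A : ObjectProperty C) : A ≤ coprodClosure A :=
  fun _ hX _ h _ _ ↦ h _ hX

lemma le_eq_leftOrthogonal (t : TStructure C) (n : ℤ) :
    t.le n = (t.ge (n + 1)).leftOrthogonal := by
  ext X
  rw [t.le_iff_isLE, t.isLE_iff_orthogonal n (n + 1) rfl]
  exact ⟨fun h Y f hY ↦ h Y f ⟨hY⟩, fun h Y f hY ↦ h f hY.ge⟩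

lemma shift_mem_leftOrthogonal_le (t : TStructure C) {X : C} {n : ℤ}
    (hX : (t.le n).leftOrthogonal X) (a m : ℤ) (h : m + a ≤ n) :
    (t.le m).leftOrthogonal (X⟦a⟧) := fun Y f hY ↦ by
  let e : X⟦a⟧⟦-a⟧ ≅ X := (shiftEquiv C a).unitIso.symm.app X
  apply (shiftFunctor C (-a)).map_injective
  rw [← cancel_epi e.inv, Functor.map_zero, comp_zero]
  exact hX _ (t.le_monotone h _ (t.le_shift m (-a) _ (by lia) Y hY))

lemma le_of_shift (t : TStructure C) {X : C} {n : ℤ} (a m : ℤ) (h : a + m = n)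
    (hX : t.le m (X⟦a⟧)) : t.le n X :=
  have : t.IsLE (X⟦a⟧) m := ⟨hX⟩
  (t.isLE_of_shift X n a m h).le

end Orthogonal

/-! ### Bounds for compact objects -/

section

variable {C : Type u} [Category.{v} C] [Preadditive C]
  [HasZeroObject C] [HasShift C ℤ] [∀ n : ℤ, (shiftFunctor C n).Additive] [Pretriangulated C]

/-- The sequence of the truncations `τ^{≥ k} X`, for `k : ℕ`. -/
noncomputable def truncSequence (t : TStructure C) (X : C) : ℕ ⥤ C where
  obj k := (t.truncGE k).obj X
  map {k l} h := (t.natTransTruncGEOfLE k l (by exact_mod_cast leOfHom h)).app X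
  map_id k := t.natTransTruncGEOfLE_refl_app k X
  map_comp _ _ := (t.natTransTruncGEOfLE_trans_app _ _ _ _ _ X).symm

/-- Compact objects are bounded above, for a t-structure such that a compact generator is. -/
lemma exists_le_of_compact (hC : HasCoproducts.{v} C) {G : C} (hG : IsCompactGenerator G)
    (t : TStructure C) {N : ℤ} (hN : t.le N G) {K : C} (hK : compactObjects C K) :
    ∃ n : ℤ, t.le n K := by
  obtain ⟨l, hl⟩ := exists_comp_map_eq_zero hC hG (truncSequence t K) (fun i k f ↦ by
    refine ⟨max k (N - i + 1).toNat, le_max_left _ _, ?_⟩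
    have : t.IsLE (G⟦i⟧) (N - i) := ⟨t.le_shift N i _ (by lia) _ hN⟩
    have : t.IsGE ((truncSequence t K).obj (max k (N - i + 1).toNat))
      (max k (N - i + 1).toNat : ℕ) :=
      inferInstanceAs (t.IsGE ((t.truncGE _).obj K) _)
    exact t.zero _ (N - i) (max k (N - i + 1).toNat : ℕ) (by lia)) hK
    ((t.truncGEπ ((0 : ℕ) : ℤ)).app K)
  have hl' : (t.truncGEπ (l : ℤ)).app K = 0 :=
    (t.π_natTransTruncGEOfLE_app ((0 : ℕ) : ℤ) l (by lia) K).symm.trans hl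
  refine ⟨l - 1, ?_⟩
  rw [t.le_iff_isLE, t.isLE_iff_orthogonal (l - 1) l (by lia)]
  intro Y f _
  rw [← t.π_descTruncGE f l, hl', zero_comp]

/-- After shifting `D` into 𝒯^{≤ 0}, the term E of its approximation is built from G⟦i⟧ with i ≤ A,
so Hom(E, 𝒯^{≤ -2A}) = 0; hence the constant 2A. -/
lemma exists_approximation {A : ℤ} {G : C} {t : TStructure C}
    (hG : (t.le (-A)).leftOrthogonal G)
    (h : ∀ F : C, t.le 0 F → ObjectProperty.extensionProduct
      (coprodClosure (shifts G (Set.Icc (-A) A))).retractClosure (t.le (-1)) F)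
    {n : ℤ} {D : C} (hD : t.le n D) :
    ∃ (D' : C) (d : D ⟶ D'), t.le (n - 1) D' ∧
      ∀ (Y : C) (g : D ⟶ Y), t.le (n - 2 * A) Y → ∃ g', g = d ≫ g' := by
  obtain ⟨E, D', a, b, c, hT, ⟨E', hE', ⟨r⟩⟩, hD'⟩ := h _ (t.le_shift n n 0 (by lia) D hD)
  have hE : (t.le (-2 * A)).leftOrthogonal E := by
    refine ObjectProperty.prop_of_retract _ r (coprodClosure_le_leftOrthogonal ?_ _ hE')
    rintro X ⟨i, hi, ⟨e⟩⟩
    rw [Set.mem_Icc] at hi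
    exact (ObjectProperty.prop_iff_of_iso _ e).2 (shift_mem_leftOrthogonal_le t hG i _ (by lia))
  let e : D'⟦-n⟧⟦n⟧ ≅ D' := (shiftEquiv C n).counitIso.app D'
  refine ⟨D'⟦-n⟧, (shiftFunctor C n).preimage (b ≫ e.inv),
    t.le_shift _ _ _ (by lia) _ hD', fun Y g hY ↦ ?_⟩
  obtain ⟨g', hg'⟩ : ∃ g' : D' ⟶ Y⟦n⟧, g⟦n⟧' = b ≫ g' := Triangle.yoneda_exact₂ _ hT (g⟦n⟧')
    (hE _ (t.le_shift _ n _ (by lia) Y hY))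
  refine ⟨(shiftFunctor C n).preimage (e.hom ≫ g'), (shiftFunctor C n).map_injective ?_⟩
  simp [hg']

/-- Iterating the approximations gives a sequence of objects of decreasing degrees. -/
lemma exists_approximation_sequence {A : ℤ} {G : C} {t : TStructure C}
    (hG : (t.le (-A)).leftOrthogonal G)
    (h : ∀ F : C, t.le 0 F → ObjectProperty.extensionProduct
      (coprodClosure (shifts G (Set.Icc (-A) A))).retractClosure (t.le (-1)) F)
    {N : ℤ} {K : C} (hK : t.le N K) :
    ∃ (F : ℕ ⥤ C) (_ : K ≅ F.obj 0), ∀ k : ℕ, t.le (N - k) (F.obj k) ∧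
      ∀ (Y : C) (g : F.obj k ⟶ Y), t.le (N - k - 2 * A) Y →
        ∃ g', g = F.map (homOfLE k.le_succ) ≫ g' := by
  choose next d hnext hd using fun (n : ℤ) (D : {D : C // t.le n D}) ↦
    exists_approximation hG h D.2
  let D (k : ℕ) : {D : C // t.le (N - k) D} :=
    Nat.rec ⟨K, by simpa using hK⟩ (fun k X ↦ ⟨next _ X, by
      simpa [sub_sub] using hnext _ X⟩) k
  refine ⟨Functor.ofSequence (X := fun k ↦ (D k).1) fun k ↦ d _ (D k), Iso.refl _,
    fun k ↦ ⟨(D k).2, fun Y g hY ↦ ?_⟩⟩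
  rw [Functor.ofSequence_map_homOfLE_succ]
  exact hd _ (D k) Y g hY

lemma exists_leftOrthogonal_of_compact_aux (hC : HasCoproducts.{v} C) {A : ℤ} {G : C}
    (hG' : IsCompactGenerator G) {t : TStructure C} (hGA : t.le A G)
    (hG : (t.le (-A)).leftOrthogonal G)
    (h : ∀ F : C, t.le 0 F → ObjectProperty.extensionProduct
      (coprodClosure (shifts G (Set.Icc (-A) A))).retractClosure (t.le (-1)) F)
    {K : C} (hK : compactObjects C K) :
    ∃ m : ℤ, (t.le m).leftOrthogonal K := by
  obtain ⟨N, hN⟩ := exists_le_of_compact hC hG' t hGA hK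
  obtain ⟨F, e, hF⟩ := exists_approximation_sequence hG h hN
  obtain ⟨l, hl⟩ := exists_comp_map_eq_zero hC hG' F (fun i k f ↦ by
    refine ⟨max k (N + A + i).toNat, le_max_left _ _, ?_⟩
    exact shift_mem_leftOrthogonal_le t hG i (N - (max k (N + A + i).toNat : ℕ)) (by lia) _
      (hF _).1) hK e.hom
  refine ⟨N - l - 2 * A, fun Y g hY ↦ ?_⟩
  -- Y is so low that a map K → Y factors successively through F_1, …, F_l, while K → F_l is zero.
  have key (j : ℕ) (hj : j ≤ l) :
      ∃ g' : F.obj j ⟶ Y, g = e.hom ≫ F.map (homOfLE j.zero_le) ≫ g' := by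
    induction j with
    | zero => exact ⟨e.inv ≫ g, by simp⟩
    | succ j ih =>
      obtain ⟨g', hg'⟩ := ih (by lia)
      obtain ⟨g'', rfl⟩ := (hF j).2 Y g' (t.le_monotone (by lia) _ hY)
      refine ⟨g'', ?_⟩
      rw [hg', ← F.map_comp_assoc]
      rfl
  obtain ⟨g', rfl⟩ := key l le_rfl
  rw [reassoc_of% hl, zero_comp]

/-- In a weakly approximable category, for each compact object `K` there is `m` such that
`Hom(K, 𝒯^{≤ m}) = 0`. -/
lemma exists_leftOrthogonal_of_compact (hC : IsWeaklyApproximable C) {t : TStructure C}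
    (ht : IsPreferred t) {K : C} (hK : compactObjects C K) :
    ∃ m : ℤ, (t.le m).leftOrthogonal K := by
  obtain ⟨hC, A, G, t₀, hA, hG, hGA, hG', h⟩ := hC
  obtain ⟨H, hH, N, hN, hN₁, -⟩ := ht
  obtain ⟨M, hM⟩ := exists_le_of_compact hC hG t₀ hGA hH.1
  -- Only this inclusion between the two t-structures is needed: `H` is compact, hence bounded above
  -- for `t₀`.
  have h₁ : t.le (-N) ≤ t₀.le M := by
    refine hN₁.trans ?_
    rw [le_eq_leftOrthogonal]
    refine coprodClosure_le_leftOrthogonal ?_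
    rw [← le_eq_leftOrthogonal]
    rintro X ⟨i, hi, ⟨e⟩⟩
    rw [Set.mem_Iic] at hi
    exact (ObjectProperty.prop_iff_of_iso _ e).2
      (t₀.le_monotone (by lia) _ (t₀.le_shift M i (M - i) (by lia) _ hM))
  obtain ⟨m, hm⟩ := exists_leftOrthogonal_of_compact_aux hC hG hGA (fun Y f hY ↦ hG' Y f hY) h hK
  refine ⟨m - M - N, fun Y f hY ↦ hm f ?_⟩
  exact le_of_shift t₀ (m - M) M (by lia) (h₁ _ (t.le_shift _ (m - M) _ (by lia) _ hY))

lemma exists_le_of_compact_of_isPreferred (hC : IsWeaklyApproximable C) {t : TStructure C}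
    (ht : IsPreferred t) {K : C} (hK : compactObjects C K) : ∃ n : ℤ, t.le n K := by
  obtain ⟨H, hH, N, hN, -, hN₂⟩ := ht
  refine exists_le_of_compact hC.1 hH t (hN₂ _ (le_coprodClosure _ _ ⟨0, by simp, ⟨?_⟩⟩)) hK
  exact ((shiftFunctorZero C ℤ).app H).symm

end

end WeakApprox

namespace WeakApprox

open scoped ZeroObject

variable {C : Type u} [Category.{v} C] [Preadditive C]
  [HasZeroObject C] [HasShift C ℤ] [∀ n : ℤ, (shiftFunctor C n).Additive] [Pretriangulated C]

/-! ### Pseudo-compact objects -/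

section PseudoCompact

variable {t : TStructure C}

lemma pseudoCompact_approx {F : C} (hF : pseudoCompact t F) (m : ℤ) :
    ObjectProperty.extensionProduct (compactObjects C) (t.le m) F :=
  ObjectProperty.monotone_extensionProduct_right _ (t.le_monotone (by lia)) _
    (hF (max 1 (-m)) (by lia))

lemma pseudoCompact_of_compact {F : C} (hF : compactObjects C F) : pseudoCompact t F :=
  fun _ _ ↦ ⟨F, 0, 𝟙 F, 0, 0, contractible_distinguished F, hF, (t.isLE_of_isZero
    (isZero_zero C) _).le⟩

lemma pseudoCompact_shift (hC : HasCoproducts.{v} C) {F : C} (hF : pseudoCompact t F) (n : ℤ) :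
    pseudoCompact t (F⟦n⟧) := fun m _ ↦ by
  obtain ⟨K, D, a, b, c, hT, hK, hD⟩ := pseudoCompact_approx hF (n - m)
  exact ⟨_, _, _, _, _, Triangle.shift_distinguished _ hT n, compact_shift hK n,
    t.le_shift _ n _ (by lia) _ hD⟩

/-- The cone of a morphism from a compact object to a pseudo-compact object is pseudo-compact. -/
lemma pseudoCompact_cone [IsTriangulated C] (hC : IsWeaklyApproximable C) (ht : IsPreferred t)
    {E F D : C} {a : E ⟶ F} {b : F ⟶ D} {c : D ⟶ E⟦(1 : ℤ)⟧} (hT : Triangle.mk a b c ∈ distTriang C)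
    (hE : compactObjects C E) (hF : pseudoCompact t F) : pseudoCompact t D := fun m _ ↦ by
  obtain ⟨n, hn⟩ := exists_leftOrthogonal_of_compact hC ht hE
  obtain ⟨K, D', a', b', c', hT', hK, hD'⟩ := pseudoCompact_approx hF (min n (-m))
  -- The lift exists because D' is below the bound for `E`; the octahedron then presents `D` as an
  -- extension of D' by the cone of `u`.
  obtain ⟨u, hu⟩ : ∃ u : E ⟶ K, a = u ≫ a' := Triangle.coyoneda_exact₂ _ hT' a
    (hn _ (t.le_monotone (by lia) _ hD'))
  obtain ⟨L, v, w, hT''⟩ := distinguished_cocone_triangle u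
  have := compact_isTriangulated hC.1
  have : (compactObjects C).IsStableUnderRetracts :=
    have := hC.1
    ⟨compact_of_retract⟩
  exact ⟨_, _, _, _, _, (someOctahedron hu.symm hT'' hT' hT).mem,
    (compactObjects C).ext_of_isTriangulatedClosed₃ _ hT'' hE hK,
    t.le_monotone (by lia) _ hD'⟩

/-- No coproduct of triangles is formed: a diagram chase shows that Hom(Z, 𝒯^{≥ n+1}) = 0, using
only Hom(Y j, 𝒯^{≥ n+1}) = 0. -/
lemma le_cone_of_isColimit {J : Type*} {K X Y : J → C} {a : ∀ j, K j ⟶ X j}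
    {b : ∀ j, X j ⟶ Y j} {c : ∀ j, Y j ⟶ (K j)⟦(1 : ℤ)⟧}
    (hT : ∀ j, Triangle.mk (a j) (b j) (c j) ∈ distTriang C) {n : ℤ} (hY : ∀ j, t.le n (Y j))
    {p : Cofan K} (hp : IsColimit p) {q : Cofan X} (hq : IsColimit q) {φ : p.pt ⟶ q.pt}
    (hφ : ∀ j, p.inj j ≫ φ = a j ≫ q.inj j) {Z : C} {ψ : q.pt ⟶ Z} {θ : Z ⟶ p.pt⟦(1 : ℤ)⟧}
    (h : Triangle.mk φ ψ θ ∈ distTriang C) : t.le n Z := by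
  rw [le_eq_leftOrthogonal]
  intro W f hW
  have hYW (j : J) (g : Y j ⟶ W) : g = 0 := by
    have := hY j
    rw [le_eq_leftOrthogonal] at this
    exact this g hW
  have hp' := Cofan.isColimitMapCoconeEquiv (shiftFunctor C (1 : ℤ)) K p
    (isColimitOfPreserves _ hp)
  have hq' := Cofan.isColimitMapCoconeEquiv (shiftFunctor C (1 : ℤ)) X q
    (isColimitOfPreserves _ hq)
  have h₁₂ : φ ≫ ψ = 0 := comp_distTriang_mor_zero₁₂ _ h
  have h₃₁ : θ ≫ φ⟦(1 : ℤ)⟧' = 0 := comp_distTriang_mor_zero₃₁ _ h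
  have hf : ψ ≫ f = 0 := by
    refine Cofan.IsColimit.hom_ext hq _ _ fun j ↦ ?_
    obtain ⟨g, hg⟩ : ∃ g : Y j ⟶ W, q.inj j ≫ ψ ≫ f = b j ≫ g :=
      Triangle.yoneda_exact₂ _ (hT j) (q.inj j ≫ ψ ≫ f) (by
        change a j ≫ q.inj j ≫ ψ ≫ f = 0
        rw [← reassoc_of% hφ j, reassoc_of% h₁₂, zero_comp, comp_zero])
    rw [hg, hYW j g, comp_zero, comp_zero]
  obtain ⟨g, rfl⟩ : ∃ g : p.pt⟦(1 : ℤ)⟧ ⟶ W, f = θ ≫ g := Triangle.yoneda_exact₃ _ h f hf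
  have key (j : J) : ∃ k : (X j)⟦(1 : ℤ)⟧ ⟶ W, (p.inj j)⟦(1 : ℤ)⟧' ≫ g = (a j)⟦(1 : ℤ)⟧' ≫ k := by
    obtain ⟨k, hk⟩ : ∃ k : (X j)⟦(1 : ℤ)⟧ ⟶ W,
        (p.inj j)⟦(1 : ℤ)⟧' ≫ g = (-(a j)⟦(1 : ℤ)⟧') ≫ k :=
      Triangle.yoneda_exact₃ _ (rot_of_distTriang _ (hT j)) ((p.inj j)⟦(1 : ℤ)⟧' ≫ g)
        (hYW j (c j ≫ (p.inj j)⟦(1 : ℤ)⟧' ≫ g))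
    exact ⟨-k, by rw [hk, Preadditive.neg_comp, Preadditive.comp_neg]⟩
  choose k hk using key
  have hg : g = φ⟦(1 : ℤ)⟧' ≫ Cofan.IsColimit.desc hq' k := by
    refine Cofan.IsColimit.hom_ext hp' _ _ fun j ↦ ?_
    have h₁ := Cofan.IsColimit.fac hq' k j
    change (q.inj j)⟦(1 : ℤ)⟧' ≫ _ = _ at h₁
    change (p.inj j)⟦(1 : ℤ)⟧' ≫ g = (p.inj j)⟦(1 : ℤ)⟧' ≫ φ⟦(1 : ℤ)⟧' ≫ _
    rw [hk, ← Functor.map_comp_assoc, hφ, Functor.map_comp_assoc, h₁]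
  rw [hg, reassoc_of% h₃₁, zero_comp]

/-- A coproduct of pseudo-compact objects whose degrees tend to `-∞` is pseudo-compact. -/
lemma pseudoCompact_of_isColimit_nat (hC : HasCoproducts.{v} C) {X : ℕ → C} {q : Cofan X}
    (hq : IsColimit q) (hX : ∀ j, pseudoCompact t (X j)) (hX' : ∀ j : ℕ, t.le (-j) (X j)) :
    pseudoCompact t q.pt := fun m hm ↦ by
  have key (j : ℕ) : ∃ (K Y : C) (a : K ⟶ X j) (b : X j ⟶ Y) (c : Y ⟶ K⟦(1 : ℤ)⟧),
      Triangle.mk a b c ∈ distTriang C ∧ compactObjects C K ∧ t.le (-m) Y ∧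
        (m.toNat ≤ j → IsZero K) := by
    by_cases hj : m.toNat ≤ j
    · exact ⟨0, X j, 0, 𝟙 _, 0, contractible_distinguished₁ _, compact_of_isZero (isZero_zero C),
        t.le_monotone (by lia) _ (hX' j), fun _ ↦ isZero_zero C⟩
    · obtain ⟨K, Y, a, b, c, hT, hK, hY⟩ := hX j m hm
      exact ⟨K, Y, a, b, c, hT, hK, hY, fun h ↦ (hj h).elim⟩
  choose K Y a b c hT hK hY hK' using key
  have : HasColimitsOfShape (Discrete ℕ) C :=
    hasColimitsOfShape_of_equivalence (Discrete.equivalence (Equiv.ulift.{v} (α := ℕ)))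
  have hp := coproductIsCoproduct K
  obtain ⟨Z, ψ, θ, h⟩ := distinguished_cocone_triangle
    (Cofan.IsColimit.desc hp fun j ↦ a j ≫ q.inj j)
  exact ⟨_, _, _, _, _, h, compact_of_isColimit_nat hp hK _ hK',
    le_cone_of_isColimit hT hY hp hq (fun j ↦ Cofan.IsColimit.fac hp _ j) h⟩

lemma exists_le_of_pseudoCompact (hC : IsWeaklyApproximable C) (ht : IsPreferred t) {F : C}
    (hF : pseudoCompact t F) : ∃ n : ℤ, t.le n F := by
  obtain ⟨K, D, a, b, c, hT, hK, hD⟩ := hF 1 one_pos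
  obtain ⟨n, hn⟩ := exists_le_of_compact_of_isPreferred hC ht hK
  exact ⟨max n (-1), (t.isLE₂ _ hT _ ⟨t.le_monotone (le_max_left _ _) _ hn⟩
    ⟨t.le_monotone (le_max_right _ _) _ hD⟩).le⟩

lemma compact_of_pseudoCompact [IsTriangulated C] (hC : IsWeaklyApproximable C)
    (ht : IsPreferred t) {F : C} (hF : pseudoCompact t F)
    (h : ∀ Q : C, pseudoCompact t Q → ∃ N : ℤ, 0 < N ∧ ∀ n : ℤ, N < n → ∀ f : F ⟶ Q⟦n⟧, f = 0) :
    compactObjects C F := by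
  have := hC.1
  -- With degree -2k, the shift by -k still leaves D_k⟦-k⟧ in 𝒯^{≤ -k}, so the degrees tend to -∞.
  choose E D a b c hT hE hD using fun k : ℕ ↦ pseudoCompact_approx hF (-2 * k)
  have : HasColimitsOfShape (Discrete ℕ) C :=
    hasColimitsOfShape_of_equivalence (Discrete.equivalence (Equiv.ulift.{v} (α := ℕ)))
  let X (k : ℕ) : C := (D k)⟦-(k : ℤ)⟧
  let q : Cofan X := Cofan.mk _ (Sigma.ι X)
  have hq : IsColimit q := coproductIsCoproduct X
  obtain ⟨N, -, hN⟩ := h _ (pseudoCompact_of_isColimit_nat hC.1 hq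
    (fun k ↦ pseudoCompact_shift hC.1 (pseudoCompact_cone hC ht (hT k) (hE k) hF) _)
    (fun k ↦ t.le_shift _ _ _ (by lia) _ (hD k)))
  let k : ℕ := N.toNat + 1
  let e : (D k)⟦-(k : ℤ)⟧⟦(k : ℤ)⟧ ≅ D k := (shiftEquiv C (k : ℤ)).counitIso.app (D k)
  have hk := hN k (by lia) (b k ≫ e.inv ≫ (q.inj k)⟦(k : ℤ)⟧')
  -- Projecting Q⟦k⟧ to its k-th summand recovers `b k`.
  have hb : b k = 0 := by
    have := hk =≫ (proj hq k)⟦(k : ℤ)⟧'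
    rwa [Category.assoc, Category.assoc, ← Functor.map_comp, inj_proj_self, CategoryTheory.Functor.map_id,
      Category.comp_id, zero_comp, ← zero_comp (f := e.inv), cancel_mono] at this
  obtain ⟨g, hg⟩ : ∃ g : F ⟶ E k, 𝟙 F = g ≫ a k :=
    Triangle.coyoneda_exact₂ _ (hT k) (𝟙 F) ((Category.id_comp _).trans hb)
  exact compact_of_retract ⟨g, a k, hg.symm⟩ (hE k)

end PseudoCompact

/-! ### Boundedness and perpendiculars of a classical generator -/

section Bounded

/-- The objects `Y` such that `Hom(Y⟦i⟧, X) = 0` for all large `i`. -/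
def eventuallyOrthogonal (X : C) : ObjectProperty C :=
  fun Y ↦ ∃ n : ℤ, ∀ i : ℤ, n ≤ i → (ObjectProperty.singleton X).leftOrthogonal (Y⟦i⟧)

instance (X : C) : (eventuallyOrthogonal X).IsStableUnderRetracts where
  of_retract := by
    rintro Y Z r ⟨n, hn⟩
    exact ⟨n, fun i hi ↦ ObjectProperty.prop_of_retract _ (r.map (shiftFunctor C i)) (hn i hi)⟩

instance (X : C) : (eventuallyOrthogonal X).IsTriangulated where
  exists_zero := ⟨0, isZero_zero C, 0, fun i _ Y f _ ↦
    ((shiftFunctor C i).map_isZero (isZero_zero C)).eq_of_src _ _⟩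
  isStableUnderShiftBy a := ⟨by
    rintro Y ⟨n, hn⟩
    refine ⟨n - a, fun i hi ↦ ?_⟩
    exact ObjectProperty.prop_of_iso _ ((shiftFunctorAdd' C a i (a + i) rfl).app Y)
      (hn (a + i) (by lia))⟩
  toIsTriangulatedClosed₂ := .mk' (by
    rintro T hT ⟨n, hn⟩ ⟨m, hm⟩
    exact ⟨max n m, fun i hi ↦ ObjectProperty.ext_of_isTriangulatedClosed₂ _ _
      (Triangle.shift_distinguished T hT i) (hn i (le_of_max_le_left hi))
      (hm i (le_of_max_le_right hi))⟩)

variable {t : TStructure C}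

lemma plus_iff_exists_rightOrthogonal [IsTriangulated C] (hC : IsWeaklyApproximable C)
    (ht : IsPreferred t) {G : C} (hG : IsClassicalGenerator G) (X : C) :
    t.plus X ↔ ∃ n : ℕ, 1 ≤ n ∧ (shifts G (Set.Iic (-(n : ℤ)))).rightOrthogonal X := by
  constructor
  · rintro ⟨m, hm⟩
    have hG' : compactObjects C G := by
      rw [← hG]
      exact ObjectProperty.le_triangEnvelope _ _ (by simp)
    obtain ⟨M, hM⟩ := exists_le_of_compact_of_isPreferred hC ht hG'
    refine ⟨(M - m).toNat + 1, by lia, fun Y f ⟨i, hi, ⟨e⟩⟩ ↦ ?_⟩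
    rw [Set.mem_Iic] at hi
    have : t.IsLE (G⟦i⟧) (M - i) := ⟨t.le_shift M i _ (by lia) _ hM⟩
    rw [← cancel_epi e.inv, comp_zero]
    exact t.zero _ (M - i) m (by lia)
  · rintro ⟨n, -, hn⟩
    obtain ⟨H, hH, N, hN, hN', -⟩ := ht
    have hH' : eventuallyOrthogonal X H := by
      refine (hG.symm.le.trans ((ObjectProperty.triangEnvelope_le_iff _).2 ?_)) _ hH.1
      intro Y hY
      obtain rfl : G = Y := by simpa using hY
      refine ⟨n, fun i hi Z f hZ ↦ ?_⟩
      obtain rfl : X = Z := by simpa using hZ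
      exact hn f ⟨i, by simpa using hi, ⟨Iso.refl _⟩⟩
    obtain ⟨m, hm⟩ := hH'
    -- Shifting X by -m turns vanishing from Σ^i H for i ≥ m into vanishing from all of H(-∞, 0].
    have key : t.le (-N) ≤ (ObjectProperty.singleton (X⟦-m⟧)).leftOrthogonal := by
      refine hN'.trans (coprodClosure_le_leftOrthogonal ?_)
      rintro Y ⟨i, hi, ⟨e⟩⟩ Z f hZ
      obtain rfl : X⟦-m⟧ = Z := by simpa using hZ
      rw [Set.mem_Iic] at hi
      let e₁ : H⟦i⟧⟦m⟧ ≅ H⟦i + m⟧ := ((shiftFunctorAdd' C i m (i + m) rfl).app H).symm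
      let e₂ : X⟦-m⟧⟦m⟧ ≅ X := (shiftEquiv C m).counitIso.app X
      rw [← cancel_epi e.inv, comp_zero]
      apply (shiftFunctor C m).map_injective
      rw [← cancel_epi e₁.inv, ← cancel_mono e₂.hom, Functor.map_zero, comp_zero, zero_comp]
      exact hm (i + m) (by lia) _ (by simp)
    have : t.IsGE (X⟦-m⟧) (-N + 1) := by
      rw [t.isGE_iff_orthogonal (-N) (-N + 1) rfl]
      exact fun Y f hY ↦ key _ hY.le f (by simp)
    exact ⟨-N + 1 - m, t.isGE_of_shift X _ (-m) (-N + 1) (by lia)⟩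

lemma boundedPseudoCompact_iff [IsTriangulated C] (hC : IsWeaklyApproximable C)
    (ht : IsPreferred t) {G : C} (hG : IsClassicalGenerator G) (X : C) :
    boundedPseudoCompact t X ↔ pseudoCompact t X ∧
      ∃ n : ℕ, 1 ≤ n ∧ (shifts G (Set.Iic (-(n : ℤ)))).rightOrthogonal X := by
  rw [← plus_iff_exists_rightOrthogonal hC ht hG]
  refine ⟨fun h ↦ ⟨h.1, h.2.1⟩, fun h ↦ ⟨h.1, h.2, ?_⟩⟩
  obtain ⟨n, hn⟩ := exists_le_of_pseudoCompact hC ht h.1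
  exact ⟨n, ⟨hn⟩⟩

end Bounded

end WeakApprox

theorem propositionP2p5 {C : Type u} [Category.{v} C] [HasZeroObject C] [HasShift C ℤ]
    [Preadditive C] [∀ n : ℤ, (shiftFunctor C n).Additive] [Pretriangulated C] [IsTriangulated C]
    (hC : WeakApprox.IsWeaklyApproximable C)
    (t : TStructure C) (ht : WeakApprox.IsPreferred t) :
    (WeakApprox.compactObjects C = fun F : C ↦ WeakApprox.pseudoCompact t F ∧
      ∀ Q : C, WeakApprox.pseudoCompact t Q →
        ∃ N : ℤ, 0 < N ∧ ∀ n : ℤ, N < n → ∀ f : F ⟶ Q⟦n⟧, f = 0) ∧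
    (∀ G : C, WeakApprox.IsClassicalGenerator G →
      WeakApprox.boundedPseudoCompact t =
        ⨆ (n : ℕ) (_ : 1 ≤ n), WeakApprox.perpIn (WeakApprox.pseudoCompact t)
          (WeakApprox.shifts G (Set.Iic (-(n : ℤ))))) ∧
    (∀ G : C, WeakApprox.IsClassicalGenerator G →
      WeakApprox.boundedCompact t =
        ⨆ (n : ℕ) (_ : 1 ≤ n), WeakApprox.perpIn (WeakApprox.compactObjects C)
          (WeakApprox.shifts G (Set.Iic (-(n : ℤ))))) := by
  refine ⟨?_, fun G hG ↦ ?_, fun G hG ↦ ?_⟩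
  · ext F
    refine ⟨fun hF ↦ ⟨WeakApprox.pseudoCompact_of_compact hF, fun Q hQ ↦ ?_⟩,
      fun hF ↦ WeakApprox.compact_of_pseudoCompact hC ht hF.1 hF.2⟩
    obtain ⟨m, hm⟩ := WeakApprox.exists_leftOrthogonal_of_compact hC ht hF
    obtain ⟨n, hn⟩ := WeakApprox.exists_le_of_pseudoCompact hC ht hQ
    exact ⟨max 1 (n - m), by lia, fun k hk f ↦
      hm f (t.le_monotone (by lia) _ (t.le_shift n k (n - k) (by lia) _ hn))⟩
  · ext X
    rw [WeakApprox.boundedPseudoCompact_iff hC ht hG]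
    simp [WeakApprox.perpIn]
  · ext X
    have h : WeakApprox.boundedCompact t X ↔ WeakApprox.compactObjects C X ∧
        ∃ n : ℕ, 1 ≤ n ∧
          (WeakApprox.shifts G (Set.Iic (-(n : ℤ)))).rightOrthogonal X := by
      refine ⟨fun h ↦ ⟨h.2, ((WeakApprox.boundedPseudoCompact_iff hC ht hG X).1 h.1).2⟩, fun h ↦
        ⟨(WeakApprox.boundedPseudoCompact_iff hC ht hG X).2
          ⟨WeakApprox.pseudoCompact_of_compact h.1, h.2⟩, h.1⟩⟩
    rw [h]
    simp [WeakApprox.perpIn]
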